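/- Let $(R,\mathfrak m)$ be a Noetherian local ring, $\mathfrak q$ an $\mathfrak m$-primary ideal, and $M$ a finitely generated $R$-module with $\dim M = 2$ and $\operatorname{depth} M > 0$. Let $\mathbb M = \{M_n\}_{n\ge 0}$ be a good $\mathfrak q$-filtration of $M$, that is, a descending chain of submodules with $M_0 = M$, $\mathfrak q M_n \subseteq M_{n+1}$ for all $n$, and $\mathfrak q M_n = M_{n+1}$ for all $n \gg 0$. Write $\lambda$ for length. An element $a\in\mathfrak q$ is called $\mathbb M$-superficial for $\mathfrak q$ if there is $c \ge 0$ with $(M_{n+1} :_M a) \cap M_c = M_n$ for all $n \ge c$. Let $a_1,a_2$ be a (maximal) $\mathbb M$-superficial sequence for $\mathfrak q$: $a_1$ is $\mathbb M$-superficial for $\mathfrak q$, and $a_2$ is superficial for $\mathfrak q$ with respect to the filtration $\{(M_n + a_1M)/a_1M\}$ of $M/a_1M$. Put $J = (a_1,a_2)$. The lengths $\lambda(M_n/M_{n+1})$ are finite and there is a unique polynomial $h_{\mathbb M}(t) \in \mathbb Z[t]$ with $\sum_{n\ge 0} \lambda(M_n/M_{n+1})\,t^n = h_{\mathbb M}(t)/(1-t)^2$;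 let $e_2(\mathbb M) = h_{\mathbb M}''(1)/2$ be the second Hilbert coefficient. The lengths $\lambda(M_{n+1}/JM_n)$ are finite, and zero for all but finitely many $n$. Then $$e_2(\mathbb M) \le \sum_{n\ge 1} n\,\lambda(M_{n+1}/JM_n).$$ Moreover, equality holds if and only if $\operatorname{depth} gr_{\mathbb M}(M) > 0$ and $(a_1M :_M a_2)\cap M_1 = a_1M$. Here $gr_{\mathbb M}(M) = \bigoplus_{n\ge0} M_n/M_{n+1}$ is regarded as a module over $gr_{\mathfrak q}(R) = \bigoplus_{n\ge 0} \mathfrak q^n/\mathfrak q^{n+1}$, and its depth is taken with respect to the ideal $\mathfrak m/\mathfrak q \oplus \bigoplus_{n\ge1}\mathfrak q^n/\mathfrak q^{n+1}$. -/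

import Mathlib

open scoped Polynomial PowerSeries

noncomputable section

/-- The `I`-depth of a module `M`: the supremum of the lengths of the `M`-regular sequences
contained in `I`. -/
def moduleDepth {R : Type*} [CommRing R] (I : Ideal R) (M : Type*) [AddCommGroup M]
    [Module R M] : ℕ∞ :=
  ⨆ (rs : List R) (_ : (∀ r ∈ rs, r ∈ I) ∧ RingTheory.Sequence.IsRegular M rs), (rs.length : ℕ∞)

/-- The quotient `P / N` of two submodules `N ≤ P` of an `S`-module. -/
def SubQuot {S : Type*} [CommRing S] {L : Type*} [AddCommGroup L] [Module S L]
    (P N : Submodule S L) : Type _ :=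
  ↥P ⧸ N.submoduleOf P

namespace SubQuot

variable {S : Type*} [CommRing S] {L : Type*} [AddCommGroup L] [Module S L]
  (P N : Submodule S L)

instance : AddCommGroup (SubQuot P N) := inferInstanceAs (AddCommGroup (↥P ⧸ N.submoduleOf P))

instance : Module S (SubQuot P N) := inferInstanceAs (Module S (↥P ⧸ N.submoduleOf P))

/-- The projection `P → P / N`. -/
def mk : ↥P →ₗ[S] SubQuot P N := (N.submoduleOf P).mkQ

theorem mk_surjective : Function.Surjective (mk P N) := (N.submoduleOf P).mkQ_surjective

theorem mk_eq_zero_iff (x : ↥P) : mk P N x = 0 ↔ (x : L) ∈ N :=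
  Submodule.Quotient.mk_eq_zero (N.submoduleOf P)

end SubQuot

/-- The length `λ(P / N)` for submodules `N ≤ P`. -/
def quotLength {R : Type*} [CommRing R] {M : Type*} [AddCommGroup M] [Module R M]
    (P N : Submodule R M) : ℕ∞ :=
  Module.length R (SubQuot P N)

/-- In the Rees algebra `⨁ q ^ n`, the ideal `⨁ q ^ (n + 1)`. -/
def assocGradedIdeal {R : Type*} [CommRing R] (q : Ideal R) : Ideal (reesAlgebra q) where
  carrier := {f | ∀ i, (f : R[X]).coeff i ∈ q ^ (i + 1)}
  add_mem' hf hg i := by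
    simpa using Ideal.add_mem _ (hf i) (hg i)
  zero_mem' i := by simp
  smul_mem' r f hf i := by
    rw [smul_eq_mul, Subalgebra.coe_mul, Polynomial.coeff_mul]
    refine Ideal.sum_mem _ ?_
    rintro ⟨j, k⟩ h
    rw [← Finset.HasAntidiagonal.mem_antidiagonal.mp h, add_assoc, pow_add]
    exact Ideal.mul_mem_mul (r.2 j) (hf k)

/-- The associated graded ring `gr_q(R) = ⨁ q ^ n / q ^ (n + 1)`, as the quotient of the Rees
algebra `⨁ q ^ n` by its ideal `⨁ q ^ (n + 1)`. -/
abbrev AssocGradedRing {R : Type*} [CommRing R] (q : Ideal R) : Type _ :=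
  reesAlgebra q ⧸ assocGradedIdeal q

/-- For a local ring `R` with maximal ideal `m`, the homogeneous ideal
`m / q ⊕ ⨁_{n ≥ 1} q ^ n / q ^ (n + 1)` of `gr_q(R)`: it is the image of the ideal of
those elements of the Rees algebra whose component of degree zero lies in `m`. -/
def assocGradedMaximalIdeal {R : Type*} [CommRing R] [IsLocalRing R] (q : Ideal R) :
    Ideal (AssocGradedRing q) :=
  ((IsLocalRing.maximalIdeal R).comap
    ((Polynomial.constantCoeff : R[X] →+* R).comp (reesAlgebra q).val.toRingHom)).map
    (Ideal.Quotient.mk (assocGradedIdeal q))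

namespace Ideal.Filtration

variable {R : Type*} [CommRing R] {M : Type*} [AddCommGroup M] [Module R M] {q : Ideal R}

/-- A good `q`-filtration of the whole module `M`: one has `M_0 = M`, and
`q M_n = M_{n+1}` for all large `n`. -/
structure IsGood (F : q.Filtration M) : Prop where
  zero_eq_top : F.N 0 = ⊤
  stable : F.Stable

/-- The filtration `{(M_n + N) / N}` of the quotient `M / N`. -/
def quotient (F : q.Filtration M) (N : Submodule R M) : q.Filtration (M ⧸ N) where
  N n := (F.N n).map N.mkQ
  mono n := Submodule.map_mono (F.mono n)
  smul_le n := by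
    rw [← Submodule.map_smul'']
    exact Submodule.map_mono (F.smul_le n)

/-- An element `a ∈ q` is superficial for the filtration if there is `c` with
`(M_{n+1} :_M a) ∩ M_c = M_n` for all `n ≥ c`. -/
def IsSuperficial (F : q.Filtration M) (a : R) : Prop :=
  a ∈ q ∧ ∃ c : ℕ, ∀ n ≥ c, (F.N (n + 1)).comap (LinearMap.lsmul R M a) ⊓ F.N c = F.N n

/-- `a_1, …, a_r` is a superficial sequence if each `a_i` is superficial for the
filtration induced on `M / (a_1, …, a_{i-1}) M`. -/
def IsSuperficialSeq (F : q.Filtration M) {r : ℕ} (a : Fin r → R) : Prop :=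
  ∀ i : Fin r,
    (F.quotient (Ideal.span (a '' {j | j < i}) • (⊤ : Submodule R M))).IsSuperficial (a i)

/-- The Hilbert function `n ↦ λ(M_n / M_{n+1})`. -/
def hilbertFun (F : q.Filtration M) (n : ℕ) : ℕ :=
  (quotLength (F.N n) (F.N (n + 1))).toNat

/-- The Hilbert series `∑ λ(M_n / M_{n+1}) t ^ n`. -/
def hilbertSeries (F : q.Filtration M) : ℤ⟦X⟧ :=
  PowerSeries.mk fun n => (F.hilbertFun n : ℤ)

/-- The defining property of the `h`-polynomial: `h = (1 - t) ^ d · ∑ λ(M_n / M_{n+1}) t ^ n`,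
with `d` the Krull dimension of `M`. -/
def IsHPolynomial (F : q.Filtration M) (h : ℤ[X]) : Prop :=
  ∃ d : ℕ, Module.supportDim R M = d ∧ (h : ℤ⟦X⟧) = (1 - PowerSeries.X) ^ d * F.hilbertSeries

open Classical in
/-- The `h`-polynomial of the filtration (and `0` if there is none). -/
def hPolynomial (F : q.Filtration M) : ℤ[X] :=
  if H : ∃ h : ℤ[X], F.IsHPolynomial h then H.choose else 0

/-- The `i`-th Hilbert coefficient `e_i = h^{(i)}(1) / i!`; the `i`-th Hasse derivative is the
`i`-th derivative divided by `i!`. -/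
def hilbertCoeff (F : q.Filtration M) (i : ℕ) : ℤ :=
  (Polynomial.hasseDeriv i F.hPolynomial).eval 1

/-- The shifted filtration `n ↦ M_{n+1}`. -/
def shift (F : q.Filtration M) : q.Filtration M where
  N n := F.N (n + 1)
  mono n := F.mono (n + 1)
  smul_le n := F.smul_le (n + 1)

/-- The associated graded module `⨁ M_n / M_{n+1}`, as the quotient of `⨁ M_n` by
`⨁ M_{n+1}`, two submodules of `M[t]` over the Rees algebra: an element of `⨁ M_n` is a
polynomial with its `n`-th coefficient in `M_n`. -/
abbrev AssocGraded (F : q.Filtration M) : Type _ := SubQuot F.submodule F.shift.submodule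

theorem assocGraded_isTorsionBySet (F : q.Filtration M) :
    Module.IsTorsionBySet (reesAlgebra q) F.AssocGraded (assocGradedIdeal q) := by
  rintro x ⟨r, hr⟩
  obtain ⟨f, rfl⟩ := SubQuot.mk_surjective F.submodule F.shift.submodule x
  refine ((SubQuot.mk F.submodule F.shift.submodule).map_smul r f).symm.trans
    ((SubQuot.mk_eq_zero_iff _ _ _).mpr fun i => ?_)
  rw [Submodule.coe_smul, Subalgebra.smul_def, PolynomialModule.smul_apply]
  apply Submodule.sum_mem
  rintro ⟨j, k⟩ e
  rw [Finset.HasAntidiagonal.mem_antidiagonal] at e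
  subst e
  have h := F.pow_smul_le (j + 1) k (Submodule.smul_mem_smul (hr j) (f.2 k))
  rwa [show j + 1 + k = j + k + 1 by omega] at h

/-- The `gr_q(R)`-module structure of `gr(M)`, induced by that over the Rees algebra. -/
instance (F : q.Filtration M) : Module (AssocGradedRing q) F.AssocGraded :=
  F.assocGraded_isTorsionBySet.module

end Ideal.Filtration

end

/-! Write A = a₁M, let G be the filtration induced on M/A, with Hilbert function H, and put v_n =
λ(M_{n+1}/JM_n). Since depth M > 0, a₁ is M-regular, so M/A has dimension one. Three sequences of
lengths control everything: u_n = λ((M_{n+1} : a₁)/M_n), w_n = λ(G_{n+1}/a₂G_n), and k_n, the length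
of the image of ker(a₂) ∩ G_n in G_n/G_{n+1}.

Evaluating λ(M/(M_{n+1} + A)) in two ways gives ∑_{j≤n} H(j) = λ(M_n/M_{n+1}) + u_n
(`quotLength_top_sup_map_lsmul`). Multiplication by a₂ on G gives H(n) + w_n = H(n+1) + w_{n+1} +
k_n (`quotLength_add_quotLength_map_lsmul`). All three sequences vanish for large n: u by
Artin–Rees, k by superficiality, w because H is bounded and hence eventually constant. So the
h-polynomial is explicit, and e₂ = ∑ n w_n - ∑ C(n+1,2) k_n - ∑ u_n (`exists_hilbertCoeff_two_eq`).

Now w_n ≤ v_n, with equality when u_n = 0, so ∑ n v_n - e₂ = ∑ (n(v_n - w_n) + C(n+1,2) k_n + u_n)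
has nonnegative terms. It vanishes exactly when every u_n is zero, which means depth gr(M) > 0, and
k_n = 0 for n ≥ 1, which is the colon condition. As C(1,2) = 0, k_0 is free; this is why the colon
is intersected with M_1. -/

/-! ### Lengths of subquotients -/

namespace SubQuot

variable {S : Type*} [CommRing S] {L : Type*} [AddCommGroup L] [Module S L]

/-- The quotient `P / (P ⊓ N)` is isomorphic to any module onto which `P` surjects with
kernel `P ⊓ N`. -/
theorem nonempty_equiv_of_surjective (P N : Submodule S L) {Q : Type*} [AddCommGroup Q] [Module S Q]
    (f : ↥P →ₗ[S] Q) (hf : Function.Surjective f) (h : ∀ x : ↥P, f x = 0 ↔ (x : L) ∈ N) :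
    Nonempty (SubQuot P N ≃ₗ[S] Q) := by
  have hk : N.submoduleOf P = LinearMap.ker f := by
    ext x
    rw [LinearMap.mem_ker, h]; rfl
  exact ⟨(Submodule.quotEquivOfEq _ _ hk).trans (f.quotKerEquivOfSurjective hf)⟩

end SubQuot

section quotLength

variable {R : Type*} [CommRing R] {M M' : Type*} [AddCommGroup M] [Module R M]
  [AddCommGroup M'] [Module R M']

theorem quotLength_eq_of_surjective (P N : Submodule R M) {Q : Type*} [AddCommGroup Q]
    [Module R Q] (f : ↥P →ₗ[R] Q) (hf : Function.Surjective f)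
    (h : ∀ x : ↥P, f x = 0 ↔ (x : M) ∈ N) : quotLength P N = Module.length R Q := by
  obtain ⟨e⟩ := SubQuot.nonempty_equiv_of_surjective P N f hf h
  exact e.length_eq

theorem quotLength_map (f : M →ₗ[R] M') (P : Submodule R M) (N : Submodule R M') :
    quotLength (P.map f) N = quotLength P (N.comap f) := by
  let g : ↥P →ₗ[R] ↥(P.map f) := f.submoduleMap P
  refine (quotLength_eq_of_surjective P (N.comap f) ((SubQuot.mk (P.map f) N).comp g) ?_ ?_).symm
  · exact (SubQuot.mk_surjective _ _).comp (f.submoduleMap_surjective P)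
  · intro x
    exact SubQuot.mk_eq_zero_iff (P.map f) N (g x)

theorem quotLength_sup (P N : Submodule R M) : quotLength (P ⊔ N) N = quotLength P N := by
  refine (quotLength_eq_of_surjective P N
    ((SubQuot.mk (P ⊔ N) N).comp (Submodule.inclusion le_sup_left)) ?_ ?_).symm
  · intro y
    obtain ⟨⟨z, hz⟩, rfl⟩ := SubQuot.mk_surjective _ _ y
    obtain ⟨p, hp, n, hn, rfl⟩ := Submodule.mem_sup.mp hz
    refine ⟨⟨p, hp⟩, ?_⟩
    rw [← sub_eq_zero, LinearMap.comp_apply, ← map_sub, SubQuot.mk_eq_zero_iff]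
    simpa using hn
  · intro x
    exact SubQuot.mk_eq_zero_iff (P ⊔ N) N _

theorem quotLength_inf_right (P N : Submodule R M) : quotLength P (P ⊓ N) = quotLength P N :=
  quotLength_eq_of_surjective P (P ⊓ N) (SubQuot.mk P N) (SubQuot.mk_surjective _ _)
    fun x => (SubQuot.mk_eq_zero_iff P N x).trans (by simp)

theorem quotLength_eq_add {A B C : Submodule R M} (hAB : A ≤ B) (hBC : B ≤ C) :
    quotLength C A = quotLength C B + quotLength B A := by
  have h₁ : B.submoduleOf C = LinearMap.ker (SubQuot.mk C B) := by
    ext x; rw [LinearMap.mem_ker, SubQuot.mk_eq_zero_iff]; rfl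
  have hf : A.submoduleOf B ≤
      LinearMap.ker ((SubQuot.mk C A).comp (Submodule.inclusion hBC)) := fun x hx => by
    rw [LinearMap.mem_ker, LinearMap.comp_apply, SubQuot.mk_eq_zero_iff]
    exact hx
  have hg : A.submoduleOf C ≤ LinearMap.ker (SubQuot.mk C B) := fun x hx => by
    rw [LinearMap.mem_ker, SubQuot.mk_eq_zero_iff]
    exact hAB hx
  let f : SubQuot B A →ₗ[R] SubQuot C A := (A.submoduleOf B).liftQ _ hf
  let g : SubQuot C A →ₗ[R] SubQuot C B := (A.submoduleOf C).liftQ _ hg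
  have hfmk : ∀ x, f (SubQuot.mk B A x) = SubQuot.mk C A (Submodule.inclusion hBC x) :=
    fun x => rfl
  have hgmk : ∀ x, g (SubQuot.mk C A x) = SubQuot.mk C B x := fun x => rfl
  have := Module.length_eq_add_of_exact f g ?_ ?_ ?_
  · rw [quotLength, this, add_comm]; rfl
  · rw [injective_iff_map_eq_zero]
    intro x hx
    obtain ⟨x, rfl⟩ := SubQuot.mk_surjective _ _ x
    rw [hfmk, SubQuot.mk_eq_zero_iff] at hx
    exact (SubQuot.mk_eq_zero_iff _ _ _).mpr hx
  · intro y
    obtain ⟨y, rfl⟩ := SubQuot.mk_surjective _ _ y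
    exact ⟨SubQuot.mk C A y, rfl⟩
  · intro y
    obtain ⟨y, rfl⟩ := SubQuot.mk_surjective _ _ y
    rw [hgmk, SubQuot.mk_eq_zero_iff]
    constructor
    · intro hy
      exact ⟨SubQuot.mk B A ⟨y, hy⟩, rfl⟩
    · rintro ⟨x, hx⟩
      obtain ⟨x, rfl⟩ := SubQuot.mk_surjective _ _ x
      rw [hfmk, ← sub_eq_zero, ← map_sub, SubQuot.mk_eq_zero_iff] at hx
      have h := B.sub_mem x.2 (hAB hx)
      simpa using h

theorem quotLength_eq_zero_iff {P N : Submodule R M} : quotLength P N = 0 ↔ P ≤ N := by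
  rw [quotLength, Module.length_eq_zero_iff]
  constructor
  · intro h x hx
    exact (SubQuot.mk_eq_zero_iff P N ⟨x, hx⟩).mp (Subsingleton.elim _ _)
  · intro h
    refine subsingleton_of_forall_eq 0 fun y => ?_
    obtain ⟨y, rfl⟩ := SubQuot.mk_surjective _ _ y
    exact (SubQuot.mk_eq_zero_iff P N y).mpr (h y.2)

theorem quotLength_anti_right (P : Submodule R M) {N N' : Submodule R M} (h : N ≤ N') :
    quotLength P N' ≤ quotLength P N := by
  rw [← quotLength_inf_right P N, ← quotLength_inf_right P N',
    quotLength_eq_add (inf_le_inf_left P h) inf_le_left]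
  exact le_self_add

theorem quotLength_mono_left {P P' : Submodule R M} (N : Submodule R M) (h : P ≤ P') :
    quotLength P N ≤ quotLength P' N := by
  rw [← quotLength_sup P N, ← quotLength_sup P' N,
    quotLength_eq_add (le_sup_right : N ≤ P ⊔ N) (sup_le_sup_right h N)]
  exact le_add_self

theorem quotLength_top (N : Submodule R M) : quotLength ⊤ N = Module.length R (M ⧸ N) :=
  quotLength_eq_of_surjective ⊤ N (N.mkQ.comp (Submodule.subtype ⊤))
    (fun y => by
      obtain ⟨y, rfl⟩ := N.mkQ_surjective y
      exact ⟨⟨y, trivial⟩, rfl⟩)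
    fun x => Submodule.Quotient.mk_eq_zero N

/-- A finitely generated module killed by an ideal `I` with `R / I` Artinian has finite length. -/
theorem Module.length_ne_top_of_le_annihilator [IsNoetherianRing R] [Module.Finite R M]
    (I : Ideal R) [IsArtinianRing (R ⧸ I)] (h : I ≤ Module.annihilator R M) :
    Module.length R M ≠ ⊤ := by
  have ht : Module.IsTorsionBySet R M I := (Module.isTorsionBySet_iff_subset_annihilator R M).mpr h
  let _ := ht.module
  have : IsScalarTower R (R ⧸ I) M := ht.isScalarTower
  have : Module.Finite (R ⧸ I) M := Module.Finite.of_restrictScalars_finite R _ _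
  have : IsArtinian (R ⧸ I) M := inferInstance
  have : IsArtinian R M := 
    isArtinian_of_surjective_algebraMap (M := M) (S := R) (R := R ⧸ I)
      Ideal.Quotient.mk_surjective
  exact Module.length_ne_top

theorem quotLength_ne_top_of_smul_le [IsNoetherianRing R] [Module.Finite R M]
    (I : Ideal R) [IsArtinianRing (R ⧸ I)] {P N : Submodule R M} (h : I • P ≤ N) :
    quotLength P N ≠ ⊤ := by
  have : Module.Finite R (SubQuot P N) :=
    Module.Finite.of_surjective (SubQuot.mk P N) (SubQuot.mk_surjective _ _)
  refine Module.length_ne_top_of_le_annihilator I fun r hr => ?_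
  rw [Module.mem_annihilator]
  intro y
  obtain ⟨y, rfl⟩ := SubQuot.mk_surjective _ _ y
  rw [← map_smul, SubQuot.mk_eq_zero_iff]
  exact h (Submodule.smul_mem_smul hr y.2)

end quotLength

/-! ### Generating functions and the second derivative at 1 -/

section HPolynomial

/-- A numerical function whose first differences are given by `H 0` followed by `d`, with `d`
supported below `B`, has rational generating series with denominator `1 - X`. -/
theorem one_sub_X_mul_mk_eq {H d : ℕ → ℤ} {B : ℕ} (hd : ∀ n ≥ B, d n = 0)
    (h : ∀ n, H (n + 1) = H n + d n) :
    (1 - PowerSeries.X) * PowerSeries.mk H =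
      ((Polynomial.C (H 0) + ∑ n ∈ Finset.range B, Polynomial.monomial (n + 1) (d n) : ℤ[X]) :
        ℤ⟦X⟧) := by
  ext n
  rw [sub_mul, one_mul, map_sub, Polynomial.coeff_coe, PowerSeries.coeff_mk]
  rcases n with _ | n
  · simp [Polynomial.finsetSum_coeff, Polynomial.coeff_monomial]
  · rw [PowerSeries.coeff_succ_X_mul, PowerSeries.coeff_mk, h n]
    simp only [Polynomial.coeff_add, Polynomial.finsetSum_coeff, Polynomial.coeff_monomial,
      Polynomial.coeff_C_succ, add_left_inj, Finset.sum_ite_eq', Finset.mem_range]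
    split_ifs with hn
    · ring
    · rw [hd n (not_lt.mp hn)]; ring

theorem mk_eq_sum_monomial {u : ℕ → ℤ} {B : ℕ} (hu : ∀ n ≥ B, u n = 0) :
    PowerSeries.mk u = ((∑ n ∈ Finset.range B, Polynomial.monomial n (u n) : ℤ[X]) : ℤ⟦X⟧) := by
  ext n
  simp only [PowerSeries.coeff_mk, Polynomial.coeff_coe, Polynomial.finsetSum_coeff,
    Polynomial.coeff_monomial, Finset.sum_ite_eq', Finset.mem_range]
  split_ifs with hn
  · rfl
  · exact hu n (not_lt.mp hn)

theorem one_sub_X_mul_mk_sum_range (H : ℕ → ℤ) :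
    (1 - PowerSeries.X) * PowerSeries.mk (fun n => ∑ j ∈ Finset.range (n + 1), H j) =
      PowerSeries.mk H := by
  ext n
  rw [sub_mul, one_mul, map_sub, PowerSeries.coeff_mk, PowerSeries.coeff_mk]
  rcases n with _ | n
  · simp
  · rw [PowerSeries.coeff_succ_X_mul, PowerSeries.coeff_mk, Finset.sum_range_succ]
    ring

/-- Expanding at 1 turns (1 - X)² into X², so the second Taylor coefficient of the product is the
constant one of U. -/
theorem hasseDeriv_two_one_sub_X_sq_mul (U : ℤ[X]) :
    (Polynomial.hasseDeriv 2 ((1 - Polynomial.X) ^ 2 * U)).eval 1 = U.eval 1 := by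
  rw [← Polynomial.taylor_coeff, Polynomial.taylor_mul, Polynomial.taylor_pow,
    show Polynomial.taylor (1 : ℤ) (1 - Polynomial.X) = -Polynomial.X by
      simp [map_sub, Polynomial.taylor_X],
    neg_sq, show (2 : ℕ) = 0 + 2 from rfl, Polynomial.coeff_X_pow_mul, Polynomial.taylor_coeff_zero]

/-- Abel summation, from C(n+1,2) - C(n,2) = n. -/
theorem sum_range_choose_two_mul_sub (w : ℕ → ℤ) (B : ℕ) :
    ∑ n ∈ Finset.range B, ((n + 1).choose 2 : ℤ) * (w n - w (n + 1)) =
      ∑ n ∈ Finset.range B, (n : ℤ) * w n - (B.choose 2 : ℤ) * w B := by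
  induction B with
  | zero => simp
  | succ B ih =>
    rw [Finset.sum_range_succ, ih, Finset.sum_range_succ, Nat.choose_succ_succ' B 1,
      Nat.choose_one_right]
    push_cast
    ring

/-- The series of partial sums is ∑H tⁿ/(1 - t), so (1 - t)²∑G tⁿ = (1 - t)∑H tⁿ - (1 - t)²∑u tⁿ.
Both terms are polynomials: the first has the finitely many differences of H as coefficients, the
second contributes ∑u to the value at 1. -/
theorem exists_polynomial_eq_one_sub_X_sq_mul {H G u w k : ℕ → ℤ} {B : ℕ}
    (hu : ∀ n ≥ B, u n = 0) (hw : ∀ n ≥ B, w n = 0) (hk : ∀ n ≥ B, k n = 0)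
    (hsum : ∀ n, ∑ j ∈ Finset.range (n + 1), H j = G n + u n)
    (hstep : ∀ n, H n + w n = H (n + 1) + w (n + 1) + k n) :
    ∃ h : ℤ[X], (h : ℤ⟦X⟧) = (1 - PowerSeries.X) ^ 2 * PowerSeries.mk G ∧
      (Polynomial.hasseDeriv 2 h).eval 1 = ∑ n ∈ Finset.range B, (n : ℤ) * w n -
        ∑ n ∈ Finset.range B, ((n + 1).choose 2 : ℤ) * k n - ∑ n ∈ Finset.range B, u n := by
  let d : ℕ → ℤ := fun n => w n - w (n + 1) - k n
  have hd : ∀ n ≥ B, d n = 0 := fun n hn => by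
    simp only [d, hw n hn, hw (n + 1) (by lia), hk n hn, sub_zero]
  have h₁ := one_sub_X_mul_mk_eq (H := H) hd fun n => by simp only [d]; linarith [hstep n]
  have h₂ := mk_eq_sum_monomial hu
  have h₃ := one_sub_X_mul_mk_sum_range H
  have h₄ : PowerSeries.mk (fun n => ∑ j ∈ Finset.range (n + 1), H j) =
      PowerSeries.mk G + PowerSeries.mk u := by
    ext n
    simp [hsum n]
  refine ⟨Polynomial.C (H 0) + ∑ n ∈ Finset.range B, Polynomial.monomial (n + 1) (d n) -
    (1 - Polynomial.X) ^ 2 * ∑ n ∈ Finset.range B, Polynomial.monomial n (u n), ?_, ?_⟩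
  · rw [Polynomial.coe_sub, ← h₁, Polynomial.coe_mul, ← h₂, ← h₃, h₄]
    simp only [Polynomial.coe_pow, Polynomial.coe_sub, Polynomial.coe_one, Polynomial.coe_X]
    ring
  · rw [map_sub, Polynomial.eval_sub, hasseDeriv_two_one_sub_X_sq_mul, map_add, map_sum,
      Polynomial.hasseDeriv_C 2 _ two_pos, zero_add, Polynomial.eval_finsetSum,
      Polynomial.eval_finsetSum]
    simp only [Polynomial.hasseDeriv_monomial, Polynomial.eval_monomial, one_pow, mul_one]
    have h := sum_range_choose_two_mul_sub w B
    rw [hw B le_rfl, mul_zero, sub_zero] at h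
    rw [← h]
    simp only [d, mul_sub, Finset.sum_sub_distrib]

end HPolynomial

/-! ### Finite length and parameters -/

section Dimension

variable {R : Type*} [CommRing R] [IsNoetherianRing R]

theorem IsLocalRing.isArtinianRing_quotient_of_radical_eq [IsLocalRing R] {q : Ideal R}
    (hq : q.radical = IsLocalRing.maximalIdeal R) : IsArtinianRing (R ⧸ q) :=
  IsLocalRing.quotient_artinian_of_mem_minimalPrimes_of_isLocalRing q <| by
    rw [← Ideal.radical_minimalPrimes, hq,
      Ideal.minimalPrimes_eq_subsingleton_self]
    rfl

variable {N : Type*} [AddCommGroup N] [Module R N] [Module.Finite R N]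

theorem Module.length_ne_top_of_supportDim_le_zero (h : Module.supportDim R N ≤ 0) :
    Module.length R N ≠ ⊤ := by
  rw [Module.supportDim_eq_ringKrullDim_quotient_annihilator] at h
  have : Ring.KrullDimLE 0 (R ⧸ Module.annihilator R N) := Ring.krullDimLE_iff.mpr h
  have : IsArtinianRing (R ⧸ Module.annihilator R N) :=
    IsNoetherianRing.isArtinianRing_of_krullDimLE_zero
  exact Module.length_ne_top_of_le_annihilator _ le_rfl

/-- A module of dimension at most one has a parameter in any given primary ideal. -/
theorem Module.exists_mem_length_quotSMulTop_ne_top [IsLocalRing R] {q : Ideal R}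
    (hq : q.radical = IsLocalRing.maximalIdeal R) (h : Module.supportDim R N ≤ 1) :
    ∃ y ∈ q, Module.length R (QuotSMulTop y N) ≠ ⊤ := by
  -- Either q lies in a minimal prime of the annihilator, which is then the maximal ideal, so N has
  -- finite length and y = 0 serves; or prime avoidance gives y outside all minimal primes, and the
  -- dimension drops.
  by_cases hm : ∃ p ∈ (Module.annihilator R N).minimalPrimes, q ≤ p
  · obtain ⟨p, hp, hqp⟩ := hm
    have hp' : p.IsPrime := hp.1.1
    have hpm : p = IsLocalRing.maximalIdeal R :=
      le_antisymm (IsLocalRing.le_maximalIdeal hp'.ne_top) (hq ▸ hp'.radical_le_iff.mpr hqp)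
    subst hpm
    have := IsLocalRing.quotient_artinian_of_mem_minimalPrimes_of_isLocalRing _ hp
    have hN := Module.length_ne_top_of_le_annihilator (M := N) (Module.annihilator R N) le_rfl
    refine ⟨0, q.zero_mem, ne_top_of_le_ne_top hN ?_⟩
    exact Module.length_le_of_surjective _ (Submodule.mkQ_surjective _)
  · have hfin := Ideal.finite_minimalPrimes_of_isNoetherianRing R (Module.annihilator R N)
    have hns : ¬ ((q : Set R) ⊆ ⋃ p ∈ (Module.annihilator R N).minimalPrimes, (p : Set R)) := by
      rw [Ideal.subset_union_prime_finite hfin ⊤ ⊤ fun p hp _ _ => hp.1.1]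
      exact hm
    obtain ⟨y, hyq, hy⟩ := Set.not_subset.mp hns
    refine ⟨y, hyq, Module.length_ne_top_of_supportDim_le_zero ?_⟩
    have := (Module.supportDim_quotSMulTop_succ_le_of_notMem_minimalPrimes (M := N) (x := y)
      fun p hp hyp => hy (Set.mem_biUnion hp hyp)).trans h
    exact ENat.WithBot.add_le_add_one_right_iff.mp (by simpa using this)

end Dimension

theorem quotLength_ne_top_of_pow_smul_le {R : Type*} [CommRing R] [IsNoetherianRing R]
    [IsLocalRing R] {M : Type*} [AddCommGroup M] [Module R M] [Module.Finite R M] {q : Ideal R}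
    (hq : q.radical = IsLocalRing.maximalIdeal R) {P N : Submodule R M} {k : ℕ}
    (h : q ^ k • P ≤ N) : quotLength P N ≠ ⊤ := by
  -- The exponent k + 1 covers k = 0, where q ^ k would be the unit ideal.
  have : IsArtinianRing (R ⧸ q ^ (k + 1)) :=
    IsLocalRing.isArtinianRing_quotient_of_radical_eq <| by
      rw [Ideal.radical_pow _ k.succ_ne_zero, hq]
  exact quotLength_ne_top_of_smul_le (q ^ (k + 1))
    ((Submodule.smul_mono_left (Ideal.pow_le_pow_right k.le_succ)).trans h)

/-- Compute λ(M/yP) through P and through yM, use λ(yM/yP) ≤ λ(M/P), and cancel λ(M/P). -/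
theorem quotLength_map_lsmul_le {R : Type*} [CommRing R] {M : Type*} [AddCommGroup M]
    [Module R M] (y : R) {P : Submodule R M} (hP : quotLength ⊤ P ≠ ⊤) :
    quotLength P (P.map (LinearMap.lsmul R M y)) ≤
      quotLength ⊤ ((⊤ : Submodule R M).map (LinearMap.lsmul R M y)) := by
  have h₁ : P.map (LinearMap.lsmul R M y) ≤ P := by
    rintro _ ⟨x, hx, rfl⟩
    exact P.smul_mem y hx
  have h₂ := quotLength_eq_add h₁ le_top
  rw [quotLength_eq_add (Submodule.map_mono le_top) le_top, quotLength_map] at h₂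
  have h₃ := quotLength_anti_right ⊤ (Submodule.le_comap_map (LinearMap.lsmul R M y) P)
  have h₄ : quotLength ⊤ P + quotLength P (P.map (LinearMap.lsmul R M y)) ≤
      quotLength ⊤ P + quotLength ⊤ ((⊤ : Submodule R M).map (LinearMap.lsmul R M y)) := by
    rw [← h₂, add_comm]
    gcongr
  exact (ENat.add_le_add_iff_left hP).mp h₄

/-! ### Length identities for a filtration -/

namespace Ideal.Filtration

section General

variable {R : Type*} [CommRing R] {M : Type*} [AddCommGroup M] [Module R M] {q : Ideal R}
  {F : q.Filtration M}

theorem map_lsmul_le (F : q.Filtration M) {a : R} (ha : a ∈ q) (n : ℕ) :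
    (F.N n).map (LinearMap.lsmul R M a) ≤ F.N (n + 1) := by
  rintro _ ⟨x, hx, rfl⟩
  exact F.smul_le n (Submodule.smul_mem_smul ha hx)

theorem le_comap_lsmul (F : q.Filtration M) {a : R} (ha : a ∈ q) (n : ℕ) :
    F.N n ≤ (F.N (n + 1)).comap (LinearMap.lsmul R M a) :=
  Submodule.map_le_iff_le_comap.mp (F.map_lsmul_le ha n)

theorem IsGood.pow_smul_top_le (hF : F.IsGood) (n : ℕ) : q ^ n • (⊤ : Submodule R M) ≤ F.N n := by
  simpa [hF.zero_eq_top] using F.pow_smul_le n 0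

theorem IsGood.exists_le_pow_smul_top (hF : F.IsGood) :
    ∃ n₀, ∀ n, F.N (n + n₀) ≤ q ^ n • (⊤ : Submodule R M) :=
  hF.stable.exists_forall_le (F' := q.stableFiltration ⊤) (by simp [Ideal.stableFiltration])

theorem IsGood.quotient (hF : F.IsGood) (A : Submodule R M) : (F.quotient A).IsGood where
  zero_eq_top := by
    change (F.N 0).map A.mkQ = ⊤
    rw [hF.zero_eq_top, Submodule.map_top, Submodule.range_mkQ]
  stable := by
    obtain ⟨n₀, h⟩ := hF.stable
    refine ⟨n₀, fun n hn => ?_⟩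
    change q • (F.N n).map A.mkQ = (F.N (n + 1)).map A.mkQ
    rw [← Submodule.map_smul'', h n hn]

theorem quotLength_top_eq_sum (hF : F.IsGood) (n : ℕ) :
    quotLength ⊤ (F.N n) = ∑ j ∈ Finset.range n, quotLength (F.N j) (F.N (j + 1)) := by
  induction n with
  | zero => simpa [hF.zero_eq_top] using quotLength_eq_zero_iff.mpr le_rfl
  | succ n ih => rw [Finset.sum_range_succ, ← ih, ← quotLength_eq_add (F.mono n) le_top]

/-- The failure of multiplication by `b` to be injective on the component of degree `n` of the
associated graded module that is accounted for by the kernel of `b` on the module. -/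
noncomputable def kerLength (F : q.Filtration M) (b : R) (n : ℕ) : ℕ∞ :=
  quotLength (F.N n ⊓ (F.N (n + 1) ⊔ LinearMap.ker (LinearMap.lsmul R M b))) (F.N (n + 1))

theorem kerLength_eq_zero_iff {b : R} {n : ℕ} : F.kerLength b n = 0 ↔
    F.N n ⊓ (F.N (n + 1) ⊔ LinearMap.ker (LinearMap.lsmul R M b)) ≤ F.N (n + 1) :=
  quotLength_eq_zero_iff

theorem quotLength_eq_add_kerLength (F : q.Filtration M) {b : R} (n : ℕ) :
    quotLength (F.N n) (F.N (n + 1)) =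
      quotLength ((F.N n).map (LinearMap.lsmul R M b)) ((F.N (n + 1)).map (LinearMap.lsmul R M b)) +
        F.kerLength b n := by
  rw [quotLength_map, Submodule.comap_map_eq, ← quotLength_inf_right (F.N n) (_ ⊔ _)]
  exact quotLength_eq_add (le_inf (F.mono n) le_sup_left) inf_le_left

/-- Filter M_n/bM_{n+1} through M_{n+1} and through bM_n, then cancel λ(bM_n/bM_{n+1}), which
differs from λ(M_n/M_{n+1}) by `kerLength`. -/
theorem quotLength_add_quotLength_map_lsmul (F : q.Filtration M)
    (hfin : ∀ n, quotLength (F.N n) (F.N (n + 1)) ≠ ⊤) {b : R} (hb : b ∈ q) (n : ℕ) :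
    quotLength (F.N n) (F.N (n + 1)) +
        quotLength (F.N (n + 1)) ((F.N n).map (LinearMap.lsmul R M b)) =
      quotLength (F.N (n + 1)) (F.N (n + 1 + 1)) +
        quotLength (F.N (n + 1 + 1)) ((F.N (n + 1)).map (LinearMap.lsmul R M b)) +
          F.kerLength b n := by
  have hle := Submodule.map_mono (f := LinearMap.lsmul R M b) (F.mono n)
  have h₁ := quotLength_eq_add ((F.map_lsmul_le hb (n + 1)).trans (F.mono _)) (F.mono n)
  have h₂ := quotLength_eq_add hle ((F.map_lsmul_le hb n).trans (F.mono n))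
  have h₃ := F.quotLength_eq_add_kerLength (b := b) n
  have hZ : quotLength ((F.N n).map (LinearMap.lsmul R M b))
      ((F.N (n + 1)).map (LinearMap.lsmul R M b)) ≠ ⊤ := by
    have := hfin n
    rw [h₃] at this
    exact fun h => this (by rw [h, top_add])
  rw [← quotLength_eq_add (F.map_lsmul_le hb n) (F.mono n),
    ← quotLength_eq_add (F.map_lsmul_le hb (n + 1)) (F.mono (n + 1))]
  rw [h₁, h₃] at h₂
  refine (ENat.add_left_injective_of_ne_top hZ) ?_
  simp only
  rw [← h₂]
  ring

/-- The lengths `λ(M / (M_{n+1} + a M))` and `λ(M_n / M_{n+1})` differ by the length of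
`(M_{n+1} :_M a) / M_n`. -/
theorem quotLength_top_sup_map_lsmul (F : q.Filtration M) {a : R} (ha : a ∈ q) {n : ℕ}
    (hfin : quotLength ⊤ (F.N n) ≠ ⊤) :
    quotLength ⊤ (F.N (n + 1) ⊔ (⊤ : Submodule R M).map (LinearMap.lsmul R M a)) =
      quotLength (F.N n) (F.N (n + 1)) +
        quotLength ((F.N (n + 1)).comap (LinearMap.lsmul R M a)) (F.N n) := by
  set A := (⊤ : Submodule R M).map (LinearMap.lsmul R M a) with hA
  -- Multiplication by a identifies M/(M_{n+1} : a) with A/(A ∩ M_{n+1}); no regularity of a is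
  -- needed.
  have h₁ := quotLength_eq_add (le_sup_left : F.N (n + 1) ≤ F.N (n + 1) ⊔ A) le_top
  rw [sup_comm (F.N (n + 1)) A, quotLength_sup A, hA, quotLength_map, ← hA,
    quotLength_eq_add (F.mono n) le_top] at h₁
  have h₂ := quotLength_eq_add (F.le_comap_lsmul ha n) le_top
  have hX : quotLength ⊤ ((F.N (n + 1)).comap (LinearMap.lsmul R M a)) ≠ ⊤ := by
    rw [h₂] at hfin
    exact fun h => hfin (by rw [h, top_add])
  rw [h₂] at h₁
  rw [sup_comm]
  refine (ENat.add_left_injective_of_ne_top hX) ?_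
  simp only
  rw [← h₁]
  ring

theorem IsSuperficial.exists_kerLength_eq_zero {b : R} (hb : F.IsSuperficial b) :
    ∃ n₀, ∀ n ≥ n₀, F.kerLength b n = 0 := by
  obtain ⟨hbq, c, hc⟩ := hb
  refine ⟨c, fun n hn => kerLength_eq_zero_iff.mpr ?_⟩
  rintro x ⟨hxn, hx⟩
  obtain ⟨y, hy, z, hz, rfl⟩ := Submodule.mem_sup.mp hx
  rw [← hc (n + 1) (by lia)]
  refine ⟨?_, F.antitone hn hxn⟩
  have hz' : b • z = 0 := hz
  have := F.map_lsmul_le hbq (n + 1) ⟨y, hy, rfl⟩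
  simpa [smul_add, hz'] using this

end General

/-! ### Superficial elements over a local ring -/

section Local

variable {R : Type*} [CommRing R] [IsNoetherianRing R] [IsLocalRing R] {M : Type*}
  [AddCommGroup M] [Module R M] [Module.Finite R M] {q : Ideal R} {F : q.Filtration M}

omit [IsNoetherianRing R] in
theorem ne_top_of_radical_eq (hq : q.radical = IsLocalRing.maximalIdeal R) : q ≠ ⊤ := by
  rintro rfl
  exact (IsLocalRing.maximalIdeal.isMaximal R).ne_top (by rw [← hq, Ideal.radical_top])

theorem IsGood.quotLength_top_ne_top (hF : F.IsGood)
    (hq : q.radical = IsLocalRing.maximalIdeal R) (n : ℕ) : quotLength ⊤ (F.N n) ≠ ⊤ :=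
  quotLength_ne_top_of_pow_smul_le hq (hF.pow_smul_top_le n)

theorem quotLength_ne_top (F : q.Filtration M)
    (hq : q.radical = IsLocalRing.maximalIdeal R) (n : ℕ) :
    quotLength (F.N n) (F.N (n + 1)) ≠ ⊤ :=
  quotLength_ne_top_of_pow_smul_le hq (k := 1) (by simpa using F.smul_le n)

theorem IsGood.eq_zero_of_forall_mem (hF : F.IsGood)
    (hq : q.radical = IsLocalRing.maximalIdeal R) {x : M} (hx : ∀ n, x ∈ F.N n) : x = 0 := by
  obtain ⟨n₀, h⟩ := hF.exists_le_pow_smul_top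
  have : x ∈ ⨅ i : ℕ, q ^ i • (⊤ : Submodule R M) :=
    Submodule.mem_iInf _ |>.mpr fun i => h i (hx _)
  rwa [Ideal.iInf_pow_smul_eq_bot_of_isLocalRing q (ne_top_of_radical_eq hq)] at this

/-- If all these lengths vanish, an element of ker b in M_1 climbs through every M_n, so it is zero
by Krull's intersection theorem. -/
theorem kerLength_eq_zero_of_ge_one_iff (hF : F.IsGood)
    (hq : q.radical = IsLocalRing.maximalIdeal R) {b : R} :
    (∀ n ≥ 1, F.kerLength b n = 0) ↔ LinearMap.ker (LinearMap.lsmul R M b) ⊓ F.N 1 = ⊥ := by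
  simp_rw [kerLength_eq_zero_iff]
  constructor
  · intro h
    rw [eq_bot_iff]
    rintro x ⟨hx, hx1⟩
    refine hF.eq_zero_of_forall_mem hq fun n => ?_
    have : x ∈ F.N (n + 1) := by
      induction n with
      | zero => exact hx1
      | succ n ih => exact h (n + 1) (by lia) ⟨ih, Submodule.mem_sup_right hx⟩
    exact F.mono n this
  · rintro h n hn x ⟨hxn, hx⟩
    obtain ⟨y, hy, z, hz, rfl⟩ := Submodule.mem_sup.mp hx
    have hzn : z ∈ F.N n := ((F.N n).add_mem_iff_right (F.mono n hy)).mp hxn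
    have hz0 : z ∈ (⊥ : Submodule R M) := h ▸ ⟨hz, F.antitone hn hzn⟩
    rw [(Submodule.mem_bot R).mp hz0, add_zero]
    exact hy

omit [IsLocalRing R] in
-- Artin–Rees removes the intersection with M_c: for large n, ax ∈ M_{n+1} forces ax ∈ a q^c M,
-- hence x ∈ q^c M ⊆ M_c by regularity.
theorem IsSuperficial.exists_comap_lsmul_le (hF : F.IsGood) {a : R} (ha : F.IsSuperficial a)
    (hreg : IsSMulRegular M a) :
    ∃ n₀, ∀ n ≥ n₀, (F.N (n + 1)).comap (LinearMap.lsmul R M a) ≤ F.N n := by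
  obtain ⟨haq, c, hc⟩ := ha
  obtain ⟨n₀, h₀⟩ := hF.exists_le_pow_smul_top
  obtain ⟨k, hk⟩ := Ideal.exists_pow_inf_eq_pow_smul q
    ((⊤ : Submodule R M).map (LinearMap.lsmul R M a))
  refine ⟨n₀ + k + c, fun n hn x hx => ?_⟩
  rw [← hc n (by lia)]
  refine ⟨hx, hF.pow_smul_top_le c ?_⟩
  have h₁ : a • x ∈ q ^ (k + c) • (⊤ : Submodule R M) ⊓
      (⊤ : Submodule R M).map (LinearMap.lsmul R M a) :=
    ⟨h₀ (k + c) (F.antitone (by lia) hx), ⟨x, trivial, rfl⟩⟩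
  rw [hk (k + c) (by lia), Nat.add_sub_cancel_left] at h₁
  have h₂ := Submodule.smul_mono (le_refl (q ^ c)) inf_le_right h₁
  rw [← Submodule.map_smul''] at h₂
  obtain ⟨x', hx', he⟩ := h₂
  rwa [← hreg he]

/-- A superficial element `b` satisfies `b M_n = M_{n+1}` for large `n` as soon as the
Hilbert function is bounded. -/
theorem IsSuperficial.exists_le_map_lsmul (hF : F.IsGood)
    (hq : q.radical = IsLocalRing.maximalIdeal R) {b : R} (hb : F.IsSuperficial b) {C : ℕ∞}
    (hC : C ≠ ⊤) (hbd : ∀ n, quotLength (F.N n) (F.N (n + 1)) ≤ C) :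
    ∃ n₀, ∀ n ≥ n₀, F.N (n + 1) ≤ (F.N n).map (LinearMap.lsmul R M b) := by
  obtain ⟨hbq, c, hc⟩ := hb
  obtain ⟨s, hs⟩ := hF.stable
  have hfin := F.quotLength_ne_top hq
  -- From degree c on, b is injective on the graded pieces, so the Hilbert function is
  -- nondecreasing. Being bounded it stabilizes, the cokernels vanish, and M_{n+1} ⊆ bM_n + qM_{n+1}
  -- for large n; Nakayama concludes.
  have hstep : ∀ n ≥ c, quotLength (F.N (n + 1)) (F.N (n + 1 + 1)) =
      quotLength (F.N (n + 1)) ((F.N n).map (LinearMap.lsmul R M b) ⊔ F.N (n + 1 + 1)) +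
        quotLength (F.N n) (F.N (n + 1)) := by
    intro n hn
    rw [quotLength_eq_add (le_sup_right : _ ≤ (F.N n).map (LinearMap.lsmul R M b) ⊔ _)
      (sup_le (F.map_lsmul_le hbq n) (F.mono _)), quotLength_sup, quotLength_map,
      ← quotLength_inf_right (F.N n) (Submodule.comap _ _)]
    congr 2
    refine le_antisymm ?_ (le_inf (F.mono n) (F.le_comap_lsmul hbq _))
    rw [← hc (n + 1) (by lia)]
    exact fun x hx => ⟨hx.2, F.antitone hn hx.1⟩
  let f : ℕ → ℕ := fun n => (quotLength (F.N (n + c)) (F.N (n + c + 1))).toNat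
  have hf : ∀ n, (f n : ℕ∞) = quotLength (F.N (n + c)) (F.N (n + c + 1)) :=
    fun n => ENat.natCast_toNat (hfin _)
  have hmono : Monotone f := monotone_nat_of_le_succ fun n => by
    rw [← Nat.cast_le (α := ℕ∞), hf, hf, Nat.add_right_comm n 1 c, hstep (n + c) (by lia)]
    exact le_add_self
  obtain ⟨v, m, hm⟩ := converges_of_monotone_of_bounded hmono (c := C.toNat) fun n => by
    rw [← Nat.cast_le (α := ℕ∞), hf, ENat.natCast_toNat hC]
    exact hbd _
  refine ⟨m + c + s, fun n hn => ?_⟩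
  obtain ⟨j, rfl⟩ : ∃ j, n = j + c := ⟨n - c, by lia⟩
  have h₁ := hstep (j + c) (by lia)
  rw [← hf j, Nat.add_right_comm j c 1, ← hf (j + 1), hm j (by lia), hm (j + 1) (by lia)] at h₁
  have h₂ := (ENat.add_left_injective_of_ne_top (ENat.natCast_ne_top v)) ((zero_add _).trans h₁)
  rw [eq_comm, quotLength_eq_zero_iff, Nat.add_right_comm j 1 c, ← hs (j + c + 1) (by lia)] at h₂
  refine Submodule.le_of_le_smul_of_le_jacobson_bot (IsNoetherian.noetherian _) ?_ h₂
  rw [IsLocalRing.jacobson_eq_maximalIdeal _ bot_ne_top, ← hq]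
  exact Ideal.le_radical

/-- For a parameter y ∈ q, λ(M_n/M_{n+1}) ≤ λ(M_n/yM_n) ≤ λ(M/yM). -/
theorem IsGood.exists_quotLength_le (hF : F.IsGood) (hq : q.radical = IsLocalRing.maximalIdeal R)
    (hdim : Module.supportDim R M ≤ 1) :
    ∃ C : ℕ∞, C ≠ ⊤ ∧ ∀ n, quotLength (F.N n) (F.N (n + 1)) ≤ C := by
  obtain ⟨y, hyq, hy⟩ := Module.exists_mem_length_quotSMulTop_ne_top (N := M) hq hdim
  refine ⟨quotLength ⊤ ((⊤ : Submodule R M).map (LinearMap.lsmul R M y)), ?_, fun n => ?_⟩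
  · rw [quotLength_top]
    exact hy
  · exact (quotLength_anti_right _ (F.map_lsmul_le hyq n)).trans
      (quotLength_map_lsmul_le y (hF.quotLength_top_ne_top hq n))

end Local

end Ideal.Filtration

theorem exists_isSMulRegular_of_moduleDepth_pos {R : Type*} [CommRing R] {I : Ideal R}
    {M : Type*} [AddCommGroup M] [Module R M] (h : 0 < moduleDepth I M) :
    ∃ r ∈ I, IsSMulRegular M r := by
  obtain ⟨rs, h⟩ := lt_iSup_iff.mp h
  obtain ⟨⟨hI, hreg⟩, h⟩ := lt_iSup_iff.mp h
  cases rs with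
  | nil => simp at h
  | cons r rs =>
    exact ⟨r, hI r (by simp), ((RingTheory.Sequence.isRegular_cons_iff M r rs).mp hreg).1⟩

namespace Ideal.Filtration

section Regular

variable {R : Type*} [CommRing R] [IsNoetherianRing R] [IsLocalRing R] {M : Type*}
  [AddCommGroup M] [Module R M] [Module.Finite R M] {q : Ideal R} {F : q.Filtration M}

/-- If ax = 0, multiplying x by a high power of a regular element of the maximal ideal puts it in
M_c; superficiality then puts it in every M_n, so it is zero. -/
theorem IsSuperficial.isSMulRegular (hF : F.IsGood)
    (hq : q.radical = IsLocalRing.maximalIdeal R) {a : R} (ha : F.IsSuperficial a)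
    (hdepth : 0 < moduleDepth (IsLocalRing.maximalIdeal R) M) : IsSMulRegular M a := by
  obtain ⟨-, c, hc⟩ := ha
  obtain ⟨y, hy, hreg⟩ := exists_isSMulRegular_of_moduleDepth_pos hdepth
  rw [← hq] at hy
  obtain ⟨s, hs⟩ := hy
  rw [isSMulRegular_iff_right_eq_zero_of_smul]
  intro x hx
  have hz : ((y ^ s) ^ c) • x = 0 := by
    refine hF.eq_zero_of_forall_mem hq fun n => F.antitone (le_max_left n c) ?_
    rw [← hc (max n c) (le_max_right n c)]
    refine ⟨?_, hF.pow_smul_top_le c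
      (Submodule.smul_mem_smul (Ideal.pow_mem_pow hs c) trivial)⟩
    change a • (y ^ s) ^ c • x ∈ F.N _
    rw [smul_comm, hx, smul_zero]
    exact zero_mem _
  exact (isSMulRegular_iff_right_eq_zero_of_smul.mp ((hreg.pow s).pow c)) x hz

end Regular

/-! ### Depth of the associated graded module -/

section Graded

variable {R : Type*} [CommRing R] {M : Type*} [AddCommGroup M] [Module R M] {q : Ideal R}
  (F : q.Filtration M)

theorem assocGraded_mk_smul (r : reesAlgebra q) (f : F.submodule) :
    (Ideal.Quotient.mk (assocGradedIdeal q) r) • SubQuot.mk F.submodule F.shift.submodule f =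
      SubQuot.mk F.submodule F.shift.submodule (r • f) :=
  (Module.IsTorsionBySet.mk_smul F.assocGraded_isTorsionBySet r _).trans
    ((SubQuot.mk F.submodule F.shift.submodule).map_smul r f).symm

theorem assocGraded_mk_eq_zero_iff (f : F.submodule) :
    SubQuot.mk F.submodule F.shift.submodule f = 0 ↔
      ∀ i, (f : PolynomialModule R M).coeff i ∈ F.N (i + 1) :=
  SubQuot.mk_eq_zero_iff _ _ f

theorem coeff_sub_apply (f g : PolynomialModule R M) (i : ℕ) :
    (f - g).coeff i = f.coeff i - g.coeff i :=
  DFunLike.congr_fun (map_sub PolynomialModule.coeffAddEquiv f g) i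

theorem coeff_reesAlgebra_smul_single (r : reesAlgebra q) (n : ℕ) (x : M) (i : ℕ) :
    (r • PolynomialModule.single R n x).coeff i =
      if n ≤ i then (r : R[X]).coeff (i - n) • x else 0 := by
  rw [Subalgebra.smul_def, PolynomialModule.smul_single_apply]

theorem single_mem_submodule {n : ℕ} {x : M} (hx : x ∈ F.N n) :
    PolynomialModule.single R n x ∈ F.submodule := by
  intro i
  rw [PolynomialModule.coeff_single, Finsupp.single_apply]
  split_ifs with h
  · exact h ▸ hx
  · exact zero_mem _

/-- The element of degree one of the Rees algebra given by `a ∈ q`. -/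
noncomputable def reesDegreeOne {a : R} (ha : a ∈ q) : reesAlgebra q :=
  ⟨Polynomial.monomial 1 a, reesAlgebra.monomial_mem.mpr (by rwa [pow_one])⟩

theorem coeff_reesDegreeOne_smul {a : R} (ha : a ∈ q) (f : PolynomialModule R M) (i : ℕ) :
    (reesDegreeOne ha • f).coeff i = if 1 ≤ i then a • f.coeff (i - 1) else 0 :=
  PolynomialModule.monomial_smul_apply 1 a f i

variable {F}

/-- Injectivity of the initial form of a in each degree lifts x one step of the filtration at a
time, starting from M_0 = M. -/
theorem comap_lsmul_le_of_forall {a : R} (h0 : F.N 0 = ⊤)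
    (h : ∀ n, ∀ x ∈ F.N n, a • x ∈ F.N (n + 2) → x ∈ F.N (n + 1)) (n : ℕ) :
    (F.N (n + 1)).comap (LinearMap.lsmul R M a) ≤ F.N n := by
  intro x hx
  have : ∀ j ≤ n, x ∈ F.N j := by
    intro j
    induction j with
    | zero => intro; rw [h0]; trivial
    | succ j ih => intro hj; exact h j x (ih (by lia)) (F.antitone (by lia) hx)
  exact this n le_rfl

variable [IsLocalRing R]

theorem mk_mem_assocGradedMaximalIdeal (r : reesAlgebra q)
    (hr : (r : R[X]).coeff 0 ∈ IsLocalRing.maximalIdeal R) :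
    Ideal.Quotient.mk (assocGradedIdeal q) r ∈ assocGradedMaximalIdeal q :=
  Ideal.mem_map_of_mem _ hr

theorem exists_of_mem_assocGradedMaximalIdeal {ξ : AssocGradedRing q}
    (h : ξ ∈ assocGradedMaximalIdeal q) : ∃ r : reesAlgebra q,
      (r : R[X]).coeff 0 ∈ IsLocalRing.maximalIdeal R ∧
        Ideal.Quotient.mk (assocGradedIdeal q) r = ξ :=
  (Ideal.mem_map_iff_of_surjective _ Ideal.Quotient.mk_surjective).mp h

/-- If a superficial element fails to be regular on the associated graded module, then no element
of the maximal homogeneous ideal is regular on it. -/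
theorem IsSuperficial.comap_lsmul_le_of_depth_pos (hF : F.IsGood)
    (hq : q.radical = IsLocalRing.maximalIdeal R) {a : R} (ha : F.IsSuperficial a)
    (hdepth : 0 < moduleDepth (R := AssocGradedRing q) (assocGradedMaximalIdeal q) F.AssocGraded)
    (n : ℕ) : (F.N (n + 1)).comap (LinearMap.lsmul R M a) ≤ F.N n := by
  obtain ⟨-, c, hc⟩ := ha
  obtain ⟨ξ, hξ, hreg⟩ := exists_isSMulRegular_of_moduleDepth_pos hdepth
  obtain ⟨r, hr, rfl⟩ := exists_of_mem_assocGradedMaximalIdeal hξ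
  rw [isSMulRegular_iff_right_eq_zero_of_smul] at hreg
  rw [← hq] at hr
  obtain ⟨s, hs⟩ := hr
  refine comap_lsmul_le_of_forall hF.zero_eq_top (fun n => ?_) n
  by_cases hn : c ≤ n
  · intro x hx hax
    rw [← hc (n + 1) (by lia)]
    exact ⟨hax, F.antitone hn hx⟩
  -- Descending induction on the degree: superficiality handles degrees from c on, and smaller c - n
  -- means higher degree.
  induction hd : c - n using Nat.strong_induction_on generalizing n with
  | _ d ih =>
  have hgt : ∀ m, n < m → ∀ x ∈ F.N m, a • x ∈ F.N (m + 2) → x ∈ F.N (m + 1) := by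
    intro m hm
    by_cases hcm : c ≤ m
    · intro x hx hax
      rw [← hc (m + 1) (by lia)]
      exact ⟨hax, F.antitone hcm hx⟩
    · exact ih (c - m) (by lia) m hcm rfl
  -- The regular element need not be homogeneous. Its components of positive degree send x to
  -- higher-degree classes killed by a, which vanish by induction, so only the degree-zero component
  -- matters. That component has a power in q, and `hpow` strips its factors one by one.
  have hone : ∀ x ∈ F.N n, a • x ∈ F.N (n + 2) → (r : R[X]).coeff 0 • x ∈ F.N (n + 1) →
      x ∈ F.N (n + 1) := by
    intro x hx hax hrx
    have h := hreg (SubQuot.mk F.submodule F.shift.submodule ⟨_, F.single_mem_submodule hx⟩) ?_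
    · have := (F.assocGraded_mk_eq_zero_iff _).mp h n
      simpa using this
    · rw [assocGraded_mk_smul, assocGraded_mk_eq_zero_iff]
      intro i
      rw [Submodule.coe_smul, coeff_reesAlgebra_smul_single]
      split_ifs with hi
      · obtain ⟨j, rfl⟩ := Nat.exists_eq_add_of_le hi
        rw [Nat.add_sub_cancel_left]
        rcases j with _ | j
        · exact hrx
        · refine hgt (n + (j + 1)) (by lia) _ ?_ ?_
          · rw [add_comm n]
            exact F.pow_smul_le (j + 1) n (Submodule.smul_mem_smul (r.2 (j + 1)) hx)
          · rw [smul_comm]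
            have := F.pow_smul_le (j + 1) (n + 2) (Submodule.smul_mem_smul (r.2 (j + 1)) hax)
            rwa [show j + 1 + (n + 2) = n + (j + 1) + 2 by ring] at this
      · exact zero_mem _
  have hpow : ∀ k, ∀ x ∈ F.N n, a • x ∈ F.N (n + 2) → (r : R[X]).coeff 0 ^ k • x ∈ F.N (n + 1) →
      x ∈ F.N (n + 1) := by
    intro k
    induction k with
    | zero => intro x _ _ h; simpa using h
    | succ k ihk =>
      intro x hx hax hrx
      refine ihk x hx hax (hone _ ((F.N n).smul_mem _ hx) ?_ ?_)
      · rw [smul_comm]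
        exact (F.N _).smul_mem _ hax
      · rwa [smul_smul, ← pow_succ']
  exact fun x hx hax => hpow s x hx hax (F.smul_le n (Submodule.smul_mem_smul hs hx))

theorem moduleDepth_assocGraded_pos {a : R} (haq : a ∈ q)
    (hne : ∃ n, ¬ F.N n ≤ F.N (n + 1))
    (h : ∀ n, (F.N (n + 1)).comap (LinearMap.lsmul R M a) ≤ F.N n) :
    0 < moduleDepth (R := AssocGradedRing q) (assocGradedMaximalIdeal q) F.AssocGraded := by
  let α : AssocGradedRing q := Ideal.Quotient.mk (assocGradedIdeal q) (reesDegreeOne haq)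
  have hα : α ∈ assocGradedMaximalIdeal q := mk_mem_assocGradedMaximalIdeal _ <| by
    simp [reesDegreeOne, Polynomial.coeff_monomial]
  have hreg : IsSMulRegular F.AssocGraded α := by
    rw [isSMulRegular_iff_right_eq_zero_of_smul]
    intro x hx
    obtain ⟨f, rfl⟩ := SubQuot.mk_surjective F.submodule F.shift.submodule x
    rw [assocGraded_mk_smul, assocGraded_mk_eq_zero_iff] at hx
    rw [assocGraded_mk_eq_zero_iff]
    intro i
    have := hx (i + 1)
    rw [Submodule.coe_smul, coeff_reesDegreeOne_smul, if_pos (by lia), Nat.add_sub_cancel] at this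
    exact h (i + 1) this
  -- If α gr(M) were all of gr(M), degree zero would give M_0 = M_1, and then inductively M_n =
  -- M_{n+1} for all n, since α raises degree by one.
  have htop : (⊤ : Submodule (AssocGradedRing q) F.AssocGraded) ≠ Ideal.ofList [α] • ⊤ := by
    intro htop
    obtain ⟨n, hn⟩ := hne
    refine hn ?_
    clear hn
    induction n with
    | zero => ?_
    | succ n ih => ?_
    all_goals
      intro x hx
      have hmem : SubQuot.mk F.submodule F.shift.submodule ⟨_, F.single_mem_submodule hx⟩ ∈
        (⊤ : Submodule (AssocGradedRing q) F.AssocGraded) := trivial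
      rw [htop, Ideal.ofList_singleton] at hmem
      obtain ⟨y, -, hy⟩ := (Submodule.mem_smul_pointwise_iff_exists _ _ _).mp
        ((Submodule.ideal_span_singleton_smul α _).le hmem)
      change α • y = _ at hy
      obtain ⟨g, rfl⟩ := SubQuot.mk_surjective F.submodule F.shift.submodule y
      rw [assocGraded_mk_smul, eq_comm, ← sub_eq_zero, ← map_sub,
        assocGraded_mk_eq_zero_iff] at hy
    · simpa [coeff_sub_apply, coeff_reesDegreeOne_smul] using hy 0
    · have h₁ := hy (n + 1)
      rw [Submodule.coe_sub, Submodule.coe_smul, coeff_sub_apply,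
        coeff_reesDegreeOne_smul, if_pos (by lia), Nat.add_sub_cancel] at h₁
      have h₂ := F.map_lsmul_le haq (n + 1) ⟨_, ih (g.2 n), rfl⟩
      have h₃ := (F.N (n + 1 + 1)).add_mem h₁ h₂
      simpa using h₃
  refine lt_of_lt_of_le zero_lt_one ?_
  refine le_iSup₂_of_le (f := fun (rs : List (AssocGradedRing q)) _ => (rs.length : ℕ∞)) [α]
    ⟨by simpa using hα, ?_⟩ (by simp)
  exact ⟨(RingTheory.Sequence.isWeaklyRegular_singleton_iff _ _).mpr hreg, htop⟩

end Graded

end Ideal.Filtration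

theorem Ideal.span_singleton_smul_eq_map_lsmul {R : Type*} [CommRing R] {M : Type*}
    [AddCommGroup M] [Module R M] (a : R) (P : Submodule R M) :
    Ideal.span {a} • P = P.map (LinearMap.lsmul R M a) :=
  Submodule.ideal_span_singleton_smul a P

namespace Ideal.Filtration

/-! ### Passage to M/a₁M -/

section Quotient

variable {R : Type*} [CommRing R] {M : Type*} [AddCommGroup M] [Module R M] {q : Ideal R}
  {F : q.Filtration M}

theorem IsSuperficial.of_quotient_bot {a : R}
    (h : (F.quotient (⊥ : Submodule R M)).IsSuperficial a) : F.IsSuperficial a := by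
  obtain ⟨ha, c, hc⟩ := h
  refine ⟨ha, c, fun n hn => le_antisymm ?_ (le_inf (F.le_comap_lsmul ha n) (F.antitone hn))⟩
  rintro x ⟨hx, hxc⟩
  have : (⊥ : Submodule R M).mkQ x ∈ (F.N n).map (⊥ : Submodule R M).mkQ :=
    (hc n hn).le ⟨⟨a • x, hx, map_smul _ a x⟩, ⟨x, hxc, rfl⟩⟩
  rw [← Submodule.mem_comap, Submodule.comap_map_mkQ, bot_sup_eq] at this
  exact this

theorem quotLength_quotient_map_lsmul (A : Submodule R M) (b : R) (n : ℕ) :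
    quotLength ((F.quotient A).N (n + 1))
        (((F.quotient A).N n).map (LinearMap.lsmul R (M ⧸ A) b)) =
      quotLength (F.N (n + 1)) (A ⊔ (F.N n).map (LinearMap.lsmul R M b)) := by
  have h : ((F.N n).map A.mkQ).map (LinearMap.lsmul R (M ⧸ A) b) =
      ((F.N n).map (LinearMap.lsmul R M b)).map A.mkQ := by
    rw [← Submodule.map_comp, ← Submodule.map_comp]
    rfl
  change quotLength ((F.N (n + 1)).map A.mkQ) (((F.N n).map A.mkQ).map _) = _
  rw [h, quotLength_map, Submodule.comap_map_mkQ]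

theorem quotLength_top_quotient (A : Submodule R M) (n : ℕ) :
    quotLength ⊤ ((F.quotient A).N n) = quotLength ⊤ (F.N n ⊔ A) := by
  have h : (⊤ : Submodule R (M ⧸ A)) = (⊤ : Submodule R M).map A.mkQ := by
    rw [Submodule.map_top, Submodule.range_mkQ]
  rw [h, quotLength_map, sup_comm, ← Submodule.comap_map_mkQ]
  rfl

theorem ker_lsmul_inf_quotient_eq_bot_iff {A : Submodule R M} (b : R) {n : ℕ} (hA : A ≤ F.N n) :
    LinearMap.ker (LinearMap.lsmul R (M ⧸ A) b) ⊓ (F.quotient A).N n = ⊥ ↔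
      A.comap (LinearMap.lsmul R M b) ⊓ F.N n = A := by
  have h₁ : (LinearMap.ker (LinearMap.lsmul R (M ⧸ A) b)).comap A.mkQ =
      A.comap (LinearMap.lsmul R M b) := by
    ext x
    exact Submodule.Quotient.mk_eq_zero A (x := b • x)
  have h₂ : ((F.quotient A).N n).comap A.mkQ = F.N n := by
    change ((F.N n).map A.mkQ).comap A.mkQ = _
    rw [Submodule.comap_map_mkQ, sup_eq_right.mpr hA]
  rw [← (Submodule.comap_injective_of_surjective A.mkQ_surjective).eq_iff, Submodule.comap_inf,
    h₁, h₂, Submodule.comap_bot, Submodule.ker_mkQ]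

variable {a b : R}

theorem span_pair_smul_le_sup_map_lsmul (P : Submodule R M) :
    Ideal.span {a, b} • P ≤
      (⊤ : Submodule R M).map (LinearMap.lsmul R M a) ⊔ P.map (LinearMap.lsmul R M b) := by
  rw [Ideal.span_insert, Submodule.sup_smul, Ideal.span_singleton_smul_eq_map_lsmul,
    Ideal.span_singleton_smul_eq_map_lsmul]
  exact sup_le_sup_right (Submodule.map_mono le_top) _

/-- If ay + bz ∈ M_{n+1} with z ∈ M_n, then ay ∈ M_{n+1}, so y ∈ M_n by hypothesis and the sum lies
in (a, b)M_n. -/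
theorem quotLength_sup_map_lsmul_eq (ha : a ∈ q) (hb : b ∈ q) {n : ℕ}
    (h : (F.N (n + 1)).comap (LinearMap.lsmul R M a) ≤ F.N n) :
    quotLength (F.N (n + 1))
        ((⊤ : Submodule R M).map (LinearMap.lsmul R M a) ⊔ (F.N n).map (LinearMap.lsmul R M b)) =
      quotLength (F.N (n + 1)) (Ideal.span {a, b} • F.N n) := by
  rw [← quotLength_inf_right _ (_ ⊔ _)]
  congr 1
  refine le_antisymm ?_ (le_inf ?_ (span_pair_smul_le_sup_map_lsmul _))
  · rintro x ⟨hx, hx'⟩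
    obtain ⟨_, ⟨y, -, rfl⟩, _, ⟨z, hz, rfl⟩, rfl⟩ := Submodule.mem_sup.mp hx'
    have hy : y ∈ F.N n := h <|
      ((F.N (n + 1)).add_mem_iff_left (F.map_lsmul_le hb n ⟨z, hz, rfl⟩)).mp hx
    exact add_mem (Submodule.smul_mem_smul (Ideal.subset_span (by simp)) hy)
      (Submodule.smul_mem_smul (Ideal.subset_span (by simp)) hz)
  · refine (Submodule.smul_mono_left ?_).trans (F.smul_le n)
    rw [Ideal.span_le]
    rintro x (rfl | rfl) <;> assumption

theorem exists_not_le_succ [IsNoetherianRing R] [IsLocalRing R] [Module.Finite R M]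
    (hF : F.IsGood) (hq : q.radical = IsLocalRing.maximalIdeal R) [Nontrivial M] :
    ∃ n, ¬ F.N n ≤ F.N (n + 1) := by
  by_contra! h
  obtain ⟨x, hx⟩ := exists_ne (0 : M)
  refine hx (hF.eq_zero_of_forall_mem hq fun n => ?_)
  induction n with
  | zero => rw [hF.zero_eq_top]; trivial
  | succ n ih => exact h n ih

theorem hilbertCoeff_eq_of_isHPolynomial {h : ℤ[X]} (H : F.IsHPolynomial h) (i : ℕ) :
    F.IsHPolynomial F.hPolynomial ∧ F.hilbertCoeff i = (Polynomial.hasseDeriv i h).eval 1 := by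
  have hex : ∃ h : ℤ[X], F.IsHPolynomial h := ⟨h, H⟩
  have hspec : F.IsHPolynomial F.hPolynomial := by
    rw [hPolynomial, dif_pos hex]
    exact hex.choose_spec
  refine ⟨hspec, ?_⟩
  obtain ⟨d, hd, hh⟩ := H
  obtain ⟨d', hd', hh'⟩ := hspec
  obtain rfl : d = d' := by exact_mod_cast hd.symm.trans hd'
  rw [hilbertCoeff, Polynomial.coe_injective ℤ (hh'.trans hh.symm)]

end Quotient

/-! ### The formula for e₂ in dimension two -/

section DimensionTwo

variable {R : Type*} [CommRing R] [IsNoetherianRing R] [IsLocalRing R] {M : Type*}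
  [AddCommGroup M] [Module R M] [Module.Finite R M] {q : Ideal R} {F : q.Filtration M}
  {a b : R}

theorem IsSuperficial.exists_le_map_lsmul_quotient
    (hq : q.radical = IsLocalRing.maximalIdeal R) (hF : F.IsGood)
    (hdim : Module.supportDim R M = 2) (hreg : IsSMulRegular M a) (haq : a ∈ q)
    (hb : (F.quotient ((⊤ : Submodule R M).map (LinearMap.lsmul R M a))).IsSuperficial b) :
    ∃ n₀, ∀ n ≥ n₀, quotLength (F.N (n + 1))
      ((⊤ : Submodule R M).map (LinearMap.lsmul R M a) ⊔
        (F.N n).map (LinearMap.lsmul R M b)) = 0 := by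
  set A := (⊤ : Submodule R M).map (LinearMap.lsmul R M a) with hA
  have ham : a ∈ IsLocalRing.maximalIdeal R := hq ▸ Ideal.le_radical haq
  have hd : Module.supportDim R (M ⧸ A) ≤ 1 := by
    have h : Module.supportDim R (M ⧸ A) + 1 = Module.supportDim R M :=
      Module.supportDim_quotSMulTop_succ_eq_supportDim hreg ham
    rw [hdim, ← one_add_one_eq_two] at h
    exact (ENat.WithBot.add_one_cancel.mp h).le
  have hG := hF.quotient A
  obtain ⟨C, hC, hbd⟩ := hG.exists_quotLength_le hq hd
  obtain ⟨n₀, h₀⟩ := hb.exists_le_map_lsmul hG hq hC hbd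
  refine ⟨n₀, fun n hn => ?_⟩
  rw [← quotLength_quotient_map_lsmul, quotLength_eq_zero_iff]
  exact h₀ n hn

/-- Eventual vanishing bounds every term: q^{n₀}M_{n+1} ⊆ M_{n₀+n+1} ⊆ JM_{n₀+n} ⊆ JM_n. -/
theorem quotLength_span_pair_smul_ne_top (hq : q.radical = IsLocalRing.maximalIdeal R)
    {J : Ideal R} {n₀ : ℕ} (h : ∀ n ≥ n₀, quotLength (F.N (n + 1)) (J • F.N n) = 0) (n : ℕ) :
    quotLength (F.N (n + 1)) (J • F.N n) ≠ ⊤ := by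
  refine quotLength_ne_top_of_pow_smul_le hq (k := n₀) ((F.pow_smul_le n₀ (n + 1)).trans ?_)
  rw [← add_assoc]
  exact (quotLength_eq_zero_iff.mp (h (n₀ + n) (by lia))).trans
    (Submodule.smul_mono (le_refl J) (F.antitone (by lia)))

/-- The second Hilbert coefficient in terms of the lengths attached to a superficial sequence
`a, b` in a two-dimensional module. -/
theorem exists_hilbertCoeff_two_eq (hq : q.radical = IsLocalRing.maximalIdeal R) (hF : F.IsGood)
    (hdim : Module.supportDim R M = 2) (hreg : IsSMulRegular M a) (ha : F.IsSuperficial a)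
    (hb : (F.quotient ((⊤ : Submodule R M).map (LinearMap.lsmul R M a))).IsSuperficial b) :
    F.IsHPolynomial F.hPolynomial ∧ ∃ u w k : ℕ → ℕ, ∃ B : ℕ,
      (∀ n, (u n : ℕ∞) = quotLength ((F.N (n + 1)).comap (LinearMap.lsmul R M a)) (F.N n)) ∧
      (∀ n, (w n : ℕ∞) = quotLength (F.N (n + 1))
        ((⊤ : Submodule R M).map (LinearMap.lsmul R M a) ⊔
          (F.N n).map (LinearMap.lsmul R M b))) ∧
      (∀ n, (k n : ℕ∞) =
        (F.quotient ((⊤ : Submodule R M).map (LinearMap.lsmul R M a))).kerLength b n) ∧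
      (∀ n ≥ B, u n = 0) ∧ (∀ n ≥ B, w n = 0) ∧ (∀ n ≥ B, k n = 0) ∧
      F.hilbertCoeff 2 = ∑ n ∈ Finset.range B, (n : ℤ) * w n -
        ∑ n ∈ Finset.range B, ((n + 1).choose 2 : ℤ) * k n - ∑ n ∈ Finset.range B, (u n : ℤ) := by
  obtain ⟨nw, hnw⟩ := hb.exists_le_map_lsmul_quotient hq hF hdim hreg ha.1
  obtain ⟨nk, hnk⟩ := hb.exists_kerLength_eq_zero
  obtain ⟨nu, hnu⟩ := ha.exists_comap_lsmul_le hF hreg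
  set A := (⊤ : Submodule R M).map (LinearMap.lsmul R M a) with hA
  set G := F.quotient A with hG
  have hGood : G.IsGood := hF.quotient A
  have hHfin := G.quotLength_ne_top hq
  have hgfin := F.quotLength_ne_top hq
  have hufin : ∀ n, quotLength ((F.N (n + 1)).comap (LinearMap.lsmul R M a)) (F.N n) ≠ ⊤ :=
    fun n => ne_top_of_le_ne_top (hF.quotLength_top_ne_top hq n) (quotLength_mono_left _ le_top)
  have hkfin : ∀ n, G.kerLength b n ≠ ⊤ :=
    fun n => ne_top_of_le_ne_top (hHfin n) (quotLength_mono_left _ inf_le_left)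
  have hwfin : ∀ n, quotLength (F.N (n + 1)) (A ⊔ (F.N n).map (LinearMap.lsmul R M b)) ≠ ⊤ := by
    intro n
    have h := quotLength_ne_top_of_pow_smul_le hq (k := nw) (P := F.N (n + 1))
      (N := A ⊔ (F.N n).map (LinearMap.lsmul R M b)) ((F.pow_smul_le nw (n + 1)).trans ?_)
    · exact h
    rw [← add_assoc]
    exact (quotLength_eq_zero_iff.mp (hnw (nw + n) (by lia))).trans
      (sup_le_sup_left (Submodule.map_mono (F.antitone (by lia))) _)
  choose u hu using fun n => ENat.ne_top_iff_exists.mp (hufin n)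
  choose k hk using fun n => ENat.ne_top_iff_exists.mp (hkfin n)
  choose w hw using fun n => ENat.ne_top_iff_exists.mp (hwfin n)
  choose H hH using fun n => ENat.ne_top_iff_exists.mp (hHfin n)
  choose g hg using fun n => ENat.ne_top_iff_exists.mp (hgfin n)
  have hu0 : ∀ n ≥ max nw (max nk nu), u n = 0 := fun n hn => by
    have := hu n
    rw [quotLength_eq_zero_iff.mpr (hnu n (by lia))] at this
    exact_mod_cast this
  have hk0 : ∀ n ≥ max nw (max nk nu), k n = 0 := fun n hn => by
    have := hk n
    rw [hnk n (by lia)] at this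
    exact_mod_cast this
  have hw0 : ∀ n ≥ max nw (max nk nu), w n = 0 := fun n hn => by
    have := hw n
    rw [hnw n (by lia)] at this
    exact_mod_cast this
  have hsum : ∀ n, ∑ j ∈ Finset.range (n + 1), H j = g n + u n := by
    intro n
    have h := quotLength_top_eq_sum hGood (n + 1)
    rw [quotLength_top_quotient,
      F.quotLength_top_sup_map_lsmul ha.1 (hF.quotLength_top_ne_top hq n), ← hg, ← hu] at h
    simp_rw [← hH] at h
    exact_mod_cast h.symm
  have hstep : ∀ n, H n + w n = H (n + 1) + w (n + 1) + k n := by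
    intro n
    have h := G.quotLength_add_quotLength_map_lsmul hHfin hb.1 n
    rw [quotLength_quotient_map_lsmul, quotLength_quotient_map_lsmul, ← hH, ← hH, ← hw, ← hw,
      ← hk] at h
    exact_mod_cast h
  obtain ⟨h, h₁, h₂⟩ := exists_polynomial_eq_one_sub_X_sq_mul
    (H := fun n => (H n : ℤ)) (G := fun n => (g n : ℤ)) (u := fun n => (u n : ℤ))
    (w := fun n => (w n : ℤ)) (k := fun n => (k n : ℤ)) (B := max nw (max nk nu))
    (fun n hn => by simp [hu0 n hn]) (fun n hn => by simp [hw0 n hn])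
    (fun n hn => by simp [hk0 n hn]) (fun n => by exact_mod_cast hsum n)
    (fun n => by exact_mod_cast hstep n)
  have hpoly : F.IsHPolynomial h := by
    refine ⟨2, hdim, h₁.trans ?_⟩
    congr 2
    ext n
    rw [hilbertFun, ← hg n, ENat.toNat_natCast]
  obtain ⟨h₃, h₄⟩ := hilbertCoeff_eq_of_isHPolynomial hpoly 2
  exact ⟨h₃, u, w, k, _, hu, hw, hk, hu0, hw0, hk0, h₄.trans h₂⟩

end DimensionTwo

end Ideal.Filtration

/-! ### The bound and the case of equality -/

theorem mainTheorem2 {R : Type*} [CommRing R] [IsNoetherianRing R] [IsLocalRing R]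
    {M : Type*} [AddCommGroup M] [Module R M] [Module.Finite R M]
    (q : Ideal R) (hq : q.radical = IsLocalRing.maximalIdeal R)
    (F : q.Filtration M) (hF : F.IsGood)
    (hdim : Module.supportDim R M = 2)
    (hdepth : 0 < moduleDepth (IsLocalRing.maximalIdeal R) M)
    (a₁ a₂ : R) (ha : F.IsSuperficialSeq ![a₁, a₂]) :
    -- the objects in the claim are well defined
    (∀ n, quotLength (F.N n) (F.N (n + 1)) ≠ ⊤) ∧
    F.IsHPolynomial F.hPolynomial ∧
    (∀ n, quotLength (F.N (n + 1)) (Ideal.span {a₁, a₂} • F.N n) ≠ ⊤) ∧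
    {n : ℕ | quotLength (F.N (n + 1)) (Ideal.span {a₁, a₂} • F.N n) ≠ 0}.Finite ∧
    -- the bound
    F.hilbertCoeff 2 ≤
      ∑ᶠ n : ℕ, (n : ℤ) *
        ((quotLength (F.N (n + 1)) (Ideal.span {a₁, a₂} • F.N n)).toNat : ℤ) ∧
    -- the case of equality
    (F.hilbertCoeff 2 =
        ∑ᶠ n : ℕ, (n : ℤ) *
          ((quotLength (F.N (n + 1)) (Ideal.span {a₁, a₂} • F.N n)).toNat : ℤ) ↔
      0 < moduleDepth (R := AssocGradedRing q) (assocGradedMaximalIdeal q) F.AssocGraded ∧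
      (Ideal.span {a₁} • (⊤ : Submodule R M)).comap (LinearMap.lsmul R M a₂) ⊓ F.N 1 =
        Ideal.span {a₁} • (⊤ : Submodule R M)) := by
  have ha₁ : F.IsSuperficial a₁ := by
    have h := ha 0
    rw [show (![a₁, a₂] '' {j : Fin 2 | j < 0}) = ∅ by simp, Ideal.span_empty,
      Submodule.bot_smul] at h
    exact h.of_quotient_bot
  have ha₂ : (F.quotient ((⊤ : Submodule R M).map (LinearMap.lsmul R M a₁))).IsSuperficial a₂ := by
    have h := ha 1
    rw [show {j : Fin 2 | j < 1} = {0} by ext j; fin_cases j <;> simp, Set.image_singleton,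
      Matrix.cons_val_zero, Ideal.span_singleton_smul_eq_map_lsmul] at h
    exact h
  have hreg := ha₁.isSMulRegular hF hq hdepth
  have : Nontrivial M := by
    rw [← Module.supportDim_ne_bot_iff_nontrivial R, hdim]
    decide
  rw [Ideal.span_singleton_smul_eq_map_lsmul]
  obtain ⟨hpoly, u, w, k, B, hu, hw, hk, hu0, hw0, hk0, he⟩ :=
    Ideal.Filtration.exists_hilbertCoeff_two_eq hq hF hdim hreg ha₁ ha₂
  have hcomap : ∀ {n}, u n = 0 → (F.N (n + 1)).comap (LinearMap.lsmul R M a₁) ≤ F.N n := by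
    intro n hn
    rw [← quotLength_eq_zero_iff, ← hu, hn, Nat.cast_zero]
  have hvw : ∀ {n}, u n = 0 → quotLength (F.N (n + 1)) (Ideal.span {a₁, a₂} • F.N n) = w n := by
    intro n hn
    rw [hw, Ideal.Filtration.quotLength_sup_map_lsmul_eq ha₁.1 ha₂.1 (hcomap hn)]
  have hv0 : ∀ n ≥ B, quotLength (F.N (n + 1)) (Ideal.span {a₁, a₂} • F.N n) = 0 := by
    intro n hn
    rw [hvw (hu0 n hn), hw0 n hn, Nat.cast_zero]
  have hvfin := Ideal.Filtration.quotLength_span_pair_smul_ne_top hq hv0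
  have hsupp : {n : ℕ | quotLength (F.N (n + 1)) (Ideal.span {a₁, a₂} • F.N n) ≠ 0} ⊆
      Finset.range B := by
    intro n hn
    by_contra h
    exact hn (hv0 n (by simpa using h))
  choose v hv using fun n => ENat.ne_top_iff_exists.mp (hvfin n)
  have hwv : ∀ n, w n ≤ v n := by
    intro n
    rw [← Nat.cast_le (α := ℕ∞), hw, hv]
    exact quotLength_anti_right _ (Ideal.Filtration.span_pair_smul_le_sup_map_lsmul _)
  have hfinsum : ∑ᶠ n : ℕ, (n : ℤ) *
      ((quotLength (F.N (n + 1)) (Ideal.span {a₁, a₂} • F.N n)).toNat : ℤ) =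
        ∑ n ∈ Finset.range B, (n : ℤ) * v n := by
    rw [finsum_eq_sum_of_support_subset (s := Finset.range B)]
    · simp_rw [← hv, ENat.toNat_natCast]
    · intro n hn
      refine hsupp fun h => hn ?_
      simp [h]
  have hterm : ∀ n ∈ Finset.range B, (0 : ℤ) ≤ (n : ℤ) * v n - (n : ℤ) * w n +
      ((n + 1).choose 2 : ℤ) * k n + u n := by
    intro n _
    have : (n : ℤ) * w n ≤ (n : ℤ) * v n := by
      exact_mod_cast Nat.mul_le_mul_left n (hwv n)
    have : (0 : ℤ) ≤ ((n + 1).choose 2 : ℤ) * k n := by positivity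
    lia
  have hdiff : ∑ n ∈ Finset.range B, (n : ℤ) * v n - F.hilbertCoeff 2 =
      ∑ n ∈ Finset.range B, ((n : ℤ) * v n - (n : ℤ) * w n +
        ((n + 1).choose 2 : ℤ) * k n + u n) := by
    rw [he]
    simp only [Finset.sum_add_distrib, Finset.sum_sub_distrib]
    ring
  have hA : (⊤ : Submodule R M).map (LinearMap.lsmul R M a₁) ≤ F.N 1 := by
    rw [← hF.zero_eq_top]
    exact F.map_lsmul_le ha₁.1 0
  refine ⟨F.quotLength_ne_top hq, hpoly, hvfin, (Finset.finite_toSet _).subset hsupp, ?_, ?_⟩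
  · rw [hfinsum, ← sub_nonneg, hdiff]
    exact Finset.sum_nonneg hterm
  rw [hfinsum, eq_comm, ← sub_eq_zero, hdiff, Finset.sum_eq_zero_iff_of_nonneg hterm,
    ← Ideal.Filtration.ker_lsmul_inf_quotient_eq_bot_iff a₂ hA,
    ← Ideal.Filtration.kerLength_eq_zero_of_ge_one_iff (hF.quotient _) hq]
  constructor
  · intro h
    -- A vanishing sum of nonnegative terms kills each summand; beyond B the vanishing is already
    -- known.
    have hz : ∀ n, u n = 0 ∧ (n + 1).choose 2 * k n = 0 := by
      intro n
      by_cases hn : n < B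
      · have h₁ := h n (Finset.mem_range.mpr hn)
        have h₂ : (n : ℤ) * w n ≤ (n : ℤ) * v n := by
          exact_mod_cast Nat.mul_le_mul_left n (hwv n)
        have h₃ : (0 : ℤ) ≤ ((n + 1).choose 2 : ℤ) * k n := by positivity
        have h₄ : ((n + 1).choose 2 : ℤ) * k n = 0 := by lia
        exact ⟨by lia, by exact_mod_cast h₄⟩
      · rw [hu0 n (not_lt.mp hn), hk0 n (not_lt.mp hn)]
        simp
    refine ⟨Ideal.Filtration.moduleDepth_assocGraded_pos ha₁.1
      (Ideal.Filtration.exists_not_le_succ hF hq) fun n => hcomap (hz n).1, fun n hn => ?_⟩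
    rw [← hk, (Nat.mul_eq_zero.mp (hz n).2).resolve_left (Nat.choose_pos (by lia)).ne',
      Nat.cast_zero]
  · rintro ⟨hgr, hker⟩ n -
    have hun : u n = 0 := by
      have := hu n
      rw [quotLength_eq_zero_iff.mpr (ha₁.comap_lsmul_le_of_depth_pos hF hq hgr n)] at this
      exact_mod_cast this
    have hvn : v n = w n := by
      have := hv n
      rw [hvw hun] at this
      exact_mod_cast this
    -- In degree zero both n and C(n+1,2) vanish, so nothing is needed of k 0.
    rcases n with _ | n
    · simp [hun]
    · have hkn : k (n + 1) = 0 := by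
        have := hk (n + 1)
        rw [hker (n + 1) (by lia)] at this
        exact_mod_cast this
      simp [hun, hvn, hkn]
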